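/- All graphs are finite and simple, and may have no vertices. A hole is a chordless cycle of length at least $4$, and $\omega(H)$ is the clique number of $H$. A tree decomposition of $H$ is a tree $T$ with a bag $X_s\subseteq V(H)$ for every node $s$ of $T$, such that every vertex and every edge of $H$ lies in some bag and, for every vertex $u$, the nodes $s$ with $u\in X_s$ induce a connected subgraph of $T$; its width is $\max_s |X_s|-1$ and its independent width is $\max_s \alpha(H[X_s])$, where $\alpha$ is the independence number. The treewidth $\mathrm{tw}(H)$ and the tree-independence number of $H$ are the minimum width and the minimum independent width of a tree decomposition of $H$. A class of graphs is hereditary if it is closed under isomorphism and under taking induced subgraphs. **Theorem.** Let $\ell\ge 4$ be an integer and let $F:\mathbb N\setminus\{0\}\to\mathbb N\setminus\{0\}$ be a super-linear function (for every $c\in\mathbb N$ there is $k\ge 1$ with $F(k)\ge ck$; for example, $F(k)/k\to\infty$) such that $F(1)=1$, $F(2)=2$ and $F(k+1)\ge F(k)+1$ for all $k\ge 1$. Then there exists a hereditary class of graphs $\mathcal C$ such that every hole in every graph of $\mathcal C$ has length at least $\ell$, $\mathcal C$ contains graphs of arbitrarily large tree-independence number, and every $H\in\mathcal C$ with at least one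 vertex satisfies $$\mathrm{tw}(H)\le 15\bigl(F(\omega(H)+1)+(\ell+1)\,\omega(H)-2\bigr).$$ Consequently the following conjecture of Dallard, Milanič and Štorgel is false: a hereditary class of graphs $\mathcal C$ has bounded tree-independence number if and only if there is a function $g$ with $\mathrm{tw}(G)\le g(\omega(G))$ for every $G\in\mathcal C$. -/

import Mathlib

/-- A tree decomposition of `G`: a (finite) tree together with a bag of vertices of `G` for every
node, such that every vertex and every edge is contained in some bag, and the nodes whose bags
contain a given vertex induce a connected subgraph of the tree. -/
structure TreeDecomposition {V : Type} (G : SimpleGraph V) where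
  Node : Type
  finite_node : Finite Node
  tree : SimpleGraph Node
  isTree : tree.IsTree
  bag : Node → Set V
  exists_mem_bag : ∀ v : V, ∃ s, v ∈ bag s
  exists_edge_bag : ∀ u v : V, G.Adj u v → ∃ s, u ∈ bag s ∧ v ∈ bag s
  connected_nodes : ∀ v : V, (tree.induce {s | v ∈ bag s}).Connected

/-- The width: the maximum of `|X_s| - 1` over all bags `X_s`. It is an integer; it equals `-1`
exactly if all bags are empty. The definition is used for finite graphs only. -/
noncomputable def TreeDecomposition.width {V : Type} {G : SimpleGraph V}
    (T : TreeDecomposition G) : ℤ :=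
  ⨆ s : T.Node, ((T.bag s).ncard : ℤ) - 1

/-- The independent width: the maximum over all bags `X_s` of the independence number of the
subgraph of `G` induced by `X_s`. -/
noncomputable def TreeDecomposition.independentWidth {V : Type} {G : SimpleGraph V}
    (T : TreeDecomposition G) : ℕ :=
  ⨆ s : T.Node, (G.induce (T.bag s)).indepNum

/-- The treewidth of a finite graph: the minimum width of a tree decomposition. -/
noncomputable def treewidth {V : Type} (G : SimpleGraph V) : ℤ :=
  sInf (Set.range fun T : TreeDecomposition G => T.width)

/-- The tree-independence number of a finite graph: the minimum independent width of a tree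
decomposition. -/
noncomputable def treeIndependenceNumber {V : Type} (G : SimpleGraph V) : ℕ :=
  sInf (Set.range fun T : TreeDecomposition G => T.independentWidth)

/-- `G` has a hole of length `n`, that is, a chordless cycle on `n ≥ 4` vertices (a copy of the
cycle `C_n` as an induced subgraph). -/
def HasHoleOfLength {V : Type} (G : SimpleGraph V) (n : ℕ) : Prop :=
  4 ≤ n ∧ Nonempty (SimpleGraph.cycleGraph n ↪g G)

/-- A class (property) of finite simple graphs. -/
abbrev GraphClass : Type 1 := ∀ (V : Type) [Finite V], SimpleGraph V → Prop

/-- A class is hereditary if it is closed under taking induced subgraphs (and isomorphic copies):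
`H ↪g G` is the type of isomorphisms of `H` onto induced subgraphs of `G`. -/
def GraphClass.IsHereditary (C : GraphClass) : Prop :=
  ∀ (V W : Type) [Finite V] [Finite W] (G : SimpleGraph V) (H : SimpleGraph W),
    C V G → Nonempty (H ↪g G) → C W H

/-- A class is `(tw, ω)`-bounded if the treewidth of its members is bounded by a function of their
clique number. -/
def GraphClass.IsTwOmegaBounded (C : GraphClass) : Prop :=
  ∃ g : ℕ → ℕ, ∀ (V : Type) [Finite V] (G : SimpleGraph V),
    C V G → treewidth G ≤ (g G.cliqueNum : ℤ)

/-- The tree-independence number of the members of the class is bounded by a constant. -/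
def GraphClass.HasBoundedTreeIndependenceNumber (C : GraphClass) : Prop :=
  ∃ c : ℕ, ∀ (V : Type) [Finite V] (G : SimpleGraph V), C V G → treeIndependenceNumber G ≤ c

/-- The Dallard–Milanič–Štorgel conjecture: a hereditary class of graphs is `(tw, ω)`-bounded if
and only if it has bounded tree-independence number. -/
def DallardMilanicStorgelConjecture : Prop :=
  ∀ C : GraphClass, C.IsHereditary →
    (C.IsTwOmegaBounded ↔ C.HasBoundedTreeIndependenceNumber)

/-- `F`, considered on the positive integers, is super-linear: it exceeds every linear function
somewhere. (In particular this holds if `F k / k` tends to infinity.) -/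
def IsSuperLinear (F : ℕ → ℕ) : Prop :=
  ∀ c : ℕ, ∃ k : ℕ, 1 ≤ k ∧ c * k ≤ F k

/-!
The graphs are the finite induced subgraphs of one infinite layered graph. Its vertices form a
forest whose layers are drawn as paths, every vertex having its children below it. The upward
neighbours of a vertex are some of the closed upward neighbours of its parent, so that upward
neighbourhoods are cliques. Among the children of a vertex `u` in layer `j`, every subset of at most
`cap j` closed upward neighbours of `u` occurs as an upward neighbourhood, and children with
non-empty upward neighbourhoods are at distance at least `ℓ` from each other. The bound `cap j` is
the largest `k` with `F (k + 1) ≤ j + 1`.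

*Holes* (`le_of_hole`). Consider the part of a hole in the lowest layer that it meets. A vertex there
cannot have both its neighbours above it, since these would be adjacent. So the part contains a path
that leaves the layer at both ends, and such a path has at least `ℓ` vertices.

*Tree-independence number* (`le_mul_treeIndependenceNumber`). The first `N` layers are connected and
pairwise adjacent. By the Helly property of subtrees, every tree decomposition has a bag that meets
all of them (`TreeDecomposition.exists_bag_meets_all`). Vertices in distinct layers are adjacent only
by upward edges, of which there are at most `d` at every vertex, so `N` of them contain an
independent set of size `N / (d + 1)` (`exists_isIndepSet`). For `N = F (m + 2) - 1` one may take
`d = m`, and the quotient is unbounded since `F` is super-linear.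

*Treewidth* (`treewidth_le_of_embedding`). Let `X` be the vertex set of an induced subgraph with
clique number `k`. A line descends from a vertex, choosing one child in each step; two lines separate
what is between them from the rest, except for the upward neighbours of their starting points. Every
vertex `u` has a child whose upward neighbours are exactly the members of `X` in the closed upward
neighbourhood of `u`, provided that `cap` is at least `k` in its layer. If lines choose this child,
then all vertices of `X` that a line visits below the first `F (k + 1)` layers remain upward
neighbours of its later vertices, so they form a clique, and the line has at most `F (k + 1) + k`
vertices in `X` (`card_onLine_le`). The regions between the lines that start in consecutive vertices
of a layer are nested, and the tree of these regions carries a tree decomposition whose bags consist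
of the lines and upward neighbourhoods at four vertices (`exists_top_inGapBag`).
-/

/-! ### Finite trees -/

/-- The graph that joins every `x ≠ r` to its parent `π x`. -/
def parentGraph {α : Type} (π : α → α) (r : α) : SimpleGraph α :=
  SimpleGraph.fromRel fun x y => x ≠ r ∧ π x = y

lemma parentGraph_adj {α : Type} {π : α → α} {r : α} {rk : α → ℕ}
    (h : ∀ x, x ≠ r → rk (π x) < rk x) {x : α} (hx : x ≠ r) : (parentGraph π r).Adj x (π x) := by
  rw [parentGraph, SimpleGraph.fromRel_adj]
  refine ⟨fun he => ?_, Or.inl ⟨hx, rfl⟩⟩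
  have := h x hx
  rw [← he] at this
  exact lt_irrefl _ this

/-- A set of nodes that has a top node, and with every other node contains its parent, induces a
connected subgraph. -/
lemma parentGraph_induce_connected {α : Type} {π : α → α} {r : α} {rk : α → ℕ}
    (h : ∀ x, x ≠ r → rk (π x) < rk x) {A : Set α} {a : α} (ha : a ∈ A)
    (hA : ∀ x ∈ A, x ≠ a → x ≠ r ∧ π x ∈ A) : ((parentGraph π r).induce A).Connected := by
  have key : ∀ n, ∀ x (hx : x ∈ A), rk x = n →
      ((parentGraph π r).induce A).Reachable ⟨x, hx⟩ ⟨a, ha⟩ := by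
    intro n
    induction n using Nat.strong_induction_on with
    | _ n ih =>
      intro x hx hn
      by_cases hxa : x = a
      · subst hxa; exact SimpleGraph.Reachable.refl _
      · obtain ⟨hr, hπ⟩ := hA x hx hxa
        refine SimpleGraph.Reachable.trans (SimpleGraph.Adj.reachable ?_)
          (ih (rk (π x)) (hn ▸ h x hr) (π x) hπ rfl)
        simpa using parentGraph_adj h hr
  have : Nonempty A := ⟨⟨a, ha⟩⟩
  refine ⟨fun x y => ?_⟩
  exact (key _ x.1 x.2 rfl).trans (key _ y.1 y.2 rfl).symm

lemma parentGraph_isTree {α : Type} [Finite α] {π : α → α} {r : α} {rk : α → ℕ}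
    (h : ∀ x, x ≠ r → rk (π x) < rk x) : (parentGraph π r).IsTree := by
  classical
  have := Fintype.ofFinite α
  have hconn : (parentGraph π r).Connected := by
    have := parentGraph_induce_connected h (A := Set.univ) (Set.mem_univ r)
      (fun x _ hx => ⟨hx, Set.mem_univ _⟩)
    exact (SimpleGraph.Iso.connected_iff (SimpleGraph.induceUnivIso _)).1 this
  rw [SimpleGraph.isTree_iff_connected_and_card]
  refine ⟨hconn, le_antisymm ?_ hconn.card_vert_le_card_edgeSet_add_one⟩
  have hsub : (parentGraph π r).edgeSet ⊆
      ((Finset.univ.erase r).image fun x => s(x, π x) : Finset (Sym2 α)) := by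
    intro e
    induction e using Sym2.ind with
    | _ x y =>
      rw [SimpleGraph.mem_edgeSet, parentGraph, SimpleGraph.fromRel_adj]
      rintro ⟨-, ⟨h1, rfl⟩ | ⟨h1, rfl⟩⟩
      · simp only [Finset.coe_image]
        exact ⟨x, by simp [h1], rfl⟩
      · simp only [Finset.coe_image]
        exact ⟨y, by simp [h1], Sym2.eq_swap⟩
  have h1 : Nat.card (parentGraph π r).edgeSet ≤ (Finset.univ.erase r).card := by
    rw [Nat.card_coe_set_eq]
    refine (Set.ncard_le_ncard hsub (Finset.finite_toSet _)).trans ?_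
    rw [Set.ncard_coe_finset]
    exact Finset.card_image_le
  have h2 : (Finset.univ.erase r).card + 1 = Nat.card α := by
    rw [Finset.card_erase_add_one (Finset.mem_univ r), Nat.card_eq_fintype_card, Finset.card_univ]
  omega

/-- In a tree, a vertex has at most one neighbour that is closer to a given root. -/
lemma SimpleGraph.IsTree.eq_of_adj_of_dist {α : Type} {T : SimpleGraph α} (hT : T.IsTree) (r : α)
    {u v w : α} (hu : T.Adj u w) (hv : T.Adj v w) (du : T.dist r w = T.dist r u + 1)
    (dv : T.dist r w = T.dist r v + 1) : u = v := by
  obtain ⟨p, hp, hpl⟩ := hT.connected.exists_path_of_dist r u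
  obtain ⟨q, hq, hql⟩ := hT.connected.exists_path_of_dist r v
  have hp' := (p.concat hu).isPath_of_length_eq_dist (by simp [hpl, du])
  have hq' := (q.concat hv).isPath_of_length_eq_dist (by simp [hql, dv])
  have := congrArg SimpleGraph.Walk.penultimate ((hT.existsUnique_path r w).unique hp' hq')
  simpa using this

/-- A path of a tree whose first step leads away from the root never returns towards it. -/
lemma SimpleGraph.IsTree.dist_lt_of_isPath {α : Type} {T : SimpleGraph α} (hT : T.IsTree) (r : α)
    {x y t : α} (h : T.Adj x y) (p : T.Walk y t) (hp : (p.cons h).IsPath)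
    (hd : T.dist r y = T.dist r x + 1) : T.dist r x < T.dist r t := by
  induction p generalizing x with
  | nil => omega
  | @cons y z t h' p ih =>
    have hxz : x ≠ z := by
      rintro rfl
      rw [SimpleGraph.Walk.cons_isPath_iff] at hp
      simp at hp
    have hp2 := (SimpleGraph.Walk.cons_isPath_iff _ _).1 hp
    rcases hT.dist_eq_dist_add_one_of_adj r h' with h1 | h1
    · exact absurd (hT.eq_of_adj_of_dist r h h'.symm hd h1) hxz
    · have := ih h' hp2.1 h1
      omega

/-- If a connected set of vertices of a tree contains a vertex `t ≠ x` that is not further from the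
root than `x`, then it contains the parent of `x`. -/
lemma SimpleGraph.IsTree.exists_closer {α : Type} {T : SimpleGraph α} (hT : T.IsTree) (r : α)
    {A : Set α} (hA : (T.induce A).Connected) {x t : α} (hx : x ∈ A) (ht : t ∈ A) (hxt : x ≠ t)
    (hd : T.dist r t ≤ T.dist r x) : ∃ y ∈ A, T.Adj y x ∧ T.dist r x = T.dist r y + 1 := by
  obtain ⟨p, hp, -⟩ := hA.exists_path_of_dist ⟨x, hx⟩ ⟨t, ht⟩
  cases p with
  | nil => exact absurd rfl hxt
  | @cons _ y _ h p =>
    have h' : T.Adj x y := by simpa using h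
    refine ⟨y, y.2, h'.symm, ?_⟩
    rcases hT.dist_eq_dist_add_one_of_adj r h' with h1 | h1
    · exact h1
    · have hp' := hp.map (f := (SimpleGraph.Embedding.induce A).toHom) Subtype.val_injective
      have := hT.dist_lt_of_isPath r h' (p.map (SimpleGraph.Embedding.induce A).toHom) hp' h1
      simp at this
      omega

/-- The Helly property of subtrees: pairwise intersecting connected sets of vertices of a tree have
a common vertex. -/
lemma SimpleGraph.IsTree.helly {α ι : Type} [Finite ι] [Nonempty ι] {T : SimpleGraph α}
    (hT : T.IsTree) (A : ι → Set α) (hA : ∀ i, (T.induce (A i)).Connected)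
    (hAA : ∀ i j, (A i ∩ A j).Nonempty) : ∃ x, ∀ i, x ∈ A i := by
  obtain ⟨r⟩ := hT.connected.nonempty
  have hmin : ∀ B : Set α, B.Nonempty → ∃ t ∈ B, ∀ x ∈ B, T.dist r t ≤ T.dist r x := by
    intro B hB
    obtain ⟨t, ht, htB⟩ := (InvImage.wf (T.dist r) Nat.lt_wfRel.wf).has_min B hB
    exact ⟨t, ht, fun x hx => not_lt.1 (htB x hx)⟩
  choose t ht htmin using fun i => hmin (A i) ((hAA i i).mono Set.inter_subset_left)
  -- The common vertex is the top of the set whose top is furthest from the root.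
  obtain ⟨i, hi⟩ := Finite.exists_max fun i => T.dist r (t i)
  refine ⟨t i, fun j => ?_⟩
  obtain ⟨x, hx, hxmin⟩ := hmin _ (hAA i j)
  by_cases hxi : x = t i
  · exact hxi ▸ hx.2
  obtain ⟨y, hy, hyx, hyd⟩ := hT.exists_closer r (hA i) hx.1 (ht i) hxi (htmin i x hx.1)
  by_cases hxj : x = t j
  · have h1 := hi j
    have h2 := htmin i y hy
    simp only [← hxj] at h1
    omega
  · obtain ⟨z, hz, hzx, hzd⟩ := hT.exists_closer r (hA j) hx.2 (ht j) hxj (htmin j x hx.2)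
    obtain rfl := hT.eq_of_adj_of_dist r hyx hzx hyd hzd
    have := hxmin y ⟨hy, hz⟩
    omega

/-! ### Treewidth and tree-independence number -/

/-- The tree decomposition with a single bag. -/
def TreeDecomposition.trivial {V : Type} (G : SimpleGraph V) : TreeDecomposition G where
  Node := Unit
  finite_node := inferInstance
  tree := ⊥
  isTree := SimpleGraph.IsTree.of_subsingleton
  bag _ := Set.univ
  exists_mem_bag _ := ⟨(), Set.mem_univ _⟩
  exists_edge_bag _ _ _ := ⟨(), Set.mem_univ _, Set.mem_univ _⟩
  connected_nodes v := by
    have : Nonempty {s : Unit | v ∈ (Set.univ : Set V)} := ⟨⟨(), Set.mem_univ _⟩⟩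
    exact ⟨fun x y => by rw [Subsingleton.elim x y]⟩

lemma TreeDecomposition.nonempty_node {V : Type} {G : SimpleGraph V} (T : TreeDecomposition G) :
    Nonempty T.Node :=
  T.isTree.connected.nonempty

lemma treewidth_le {V : Type} {G : SimpleGraph V} (T : TreeDecomposition G) {n : ℤ}
    (h : ∀ s, ((T.bag s).ncard : ℤ) - 1 ≤ n) : treewidth G ≤ n := by
  have := T.nonempty_node
  have hbdd : BddBelow (Set.range fun T : TreeDecomposition G => T.width) := by
    refine ⟨-1, ?_⟩
    rintro _ ⟨T', rfl⟩
    have := T'.finite_node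
    obtain ⟨s⟩ := T'.nonempty_node
    refine le_trans ?_ (le_ciSup (f := fun s => ((T'.bag s).ncard : ℤ) - 1)
        (Set.finite_range _).bddAbove s)
    omega
  exact (csInf_le hbdd ⟨T, rfl⟩).trans (ciSup_le h)

lemma le_treeIndependenceNumber {V : Type} {G : SimpleGraph V} {n : ℕ}
    (h : ∀ T : TreeDecomposition G, ∃ s, n ≤ (G.induce (T.bag s)).indepNum) :
    n ≤ treeIndependenceNumber G := by
  refine le_csInf ⟨_, TreeDecomposition.trivial G, rfl⟩ ?_
  rintro _ ⟨T, rfl⟩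
  have := T.finite_node
  obtain ⟨s, hs⟩ := h T
  exact hs.trans (le_ciSup (f := fun s => (G.induce (T.bag s)).indepNum)
    (Set.finite_range _).bddAbove s)

/-- The upper bound on treewidth given by a tree that is described by parent pointers `π`: for
every vertex `v`, the nodes whose bags contain `v` have a top node. -/
lemma treewidth_le_of_parent {V : Type} (G : SimpleGraph V) {α : Type} [Finite α]
    (π : α → α) (r : α) (rk : α → ℕ) (h : ∀ x, x ≠ r → rk (π x) < rk x) (bag : α → Set V)
    (hedge : ∀ u v, G.Adj u v → ∃ x, u ∈ bag x ∧ v ∈ bag x)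
    (htop : ∀ v, ∃ a, v ∈ bag a ∧ ∀ x, v ∈ bag x → x ≠ a → x ≠ r ∧ v ∈ bag (π x))
    {n : ℤ} (hcard : ∀ x, ((bag x).ncard : ℤ) - 1 ≤ n) : treewidth G ≤ n :=
  treewidth_le
    { Node := α
      finite_node := inferInstance
      tree := parentGraph π r
      isTree := parentGraph_isTree h
      bag := bag
      exists_mem_bag := fun v => (htop v).imp fun _ ha => ha.1
      exists_edge_bag := hedge
      connected_nodes := fun v => by
        obtain ⟨a, ha, hA⟩ := htop v
        exact parentGraph_induce_connected h ha hA } hcard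

/-- A bramble-like lower bound: if `B i` are finitely many vertex sets, each of which meets a
connected set of nodes, and any two meet a common bag, then some bag meets all of them. -/
lemma TreeDecomposition.exists_bag_meets_all {V ι : Type} [Finite ι] [Nonempty ι]
    {G : SimpleGraph V} (T : TreeDecomposition G) (B : ι → Set V)
    (hB : ∀ i, (T.tree.induce {s | (T.bag s ∩ B i).Nonempty}).Connected)
    (hBB : ∀ i j, ∃ s, (T.bag s ∩ B i).Nonempty ∧ (T.bag s ∩ B j).Nonempty) :
    ∃ s, ∀ i, (T.bag s ∩ B i).Nonempty :=
  T.isTree.helly (fun i => {s | (T.bag s ∩ B i).Nonempty}) hB hBB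

/-! ### The layered graph -/

/-- The set of upward neighbours of the vertex at position `p` of layer `j` of the layered graph.
The vertex `(j + 1, p)` is a child of the vertex `u = (j, p / (ℓ * 2 ^ (j + 1)))`. If `ℓ` divides
`p`, then the binary digits of `p / ℓ` select a subset of `u` and its upward neighbours (there is
at most one of these in every layer, so that the layers serve as names), which is the set of upward
neighbours of `(j + 1, p)` unless it has more than `cap (j + 1)` elements. In all other cases
`(j + 1, p)` has no upward neighbours. The digits of `p / ℓ` beyond the first `j + 1` play no role,
so that all subsets occur among the `ℓ * 2 ^ (j + 1)` children of `u`, at distance at least `ℓ` from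
each other. -/
def up (ℓ : ℕ) (cap : ℕ → ℕ) : ℕ → ℕ → Finset (ℕ × ℕ)
  | 0, _ => ∅
  | j + 1, p =>
    let S := (insert (j, p / (ℓ * 2 ^ (j + 1))) (up ℓ cap j (p / (ℓ * 2 ^ (j + 1))))).filter
      fun w => (p / ℓ).testBit w.1
    if ℓ ∣ p ∧ S.card ≤ cap (j + 1) then S else ∅

/-- The closed upward neighbourhood of a vertex of the layered graph. -/
def closedUp (ℓ : ℕ) (cap : ℕ → ℕ) (v : ℕ × ℕ) : Finset (ℕ × ℕ) :=
  insert v (up ℓ cap v.1 v.2)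

/-- The parent of a vertex in the preceding layer; a vertex of layer `0` is mapped to a vertex of
layer `0`, which has no meaning. -/
def parentVertex (ℓ : ℕ) (v : ℕ × ℕ) : ℕ × ℕ :=
  (v.1 - 1, v.2 / (ℓ * 2 ^ v.1))

/-- The layered graph on `ℕ × ℕ`, where `(j, p)` is the vertex at position `p` of layer `j`. Every
layer is a one-way infinite path, and the edges between layers join every vertex to its upward
neighbours. -/
def layeredGraph (ℓ : ℕ) (cap : ℕ → ℕ) : SimpleGraph (ℕ × ℕ) :=
  SimpleGraph.fromRel fun u v => (u.1 = v.1 ∧ u.2 + 1 = v.2) ∨ u ∈ up ℓ cap v.1 v.2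

section LayeredGraph

variable {ℓ : ℕ} {cap : ℕ → ℕ}

lemma mem_closedUp {u v : ℕ × ℕ} : u ∈ closedUp ℓ cap v ↔ u = v ∨ u ∈ up ℓ cap v.1 v.2 :=
  Finset.mem_insert

lemma self_mem_closedUp (v : ℕ × ℕ) : v ∈ closedUp ℓ cap v :=
  Finset.mem_insert_self _ _

lemma up_succ_subset (j p : ℕ) :
    up ℓ cap (j + 1) p ⊆ closedUp ℓ cap (j, p / (ℓ * 2 ^ (j + 1))) := by
  rw [up]
  split_ifs
  · exact Finset.filter_subset _ _
  · exact Finset.empty_subset _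

lemma up_card_le (j p : ℕ) : (up ℓ cap j p).card ≤ cap j := by
  cases j with
  | zero => simp [up]
  | succ j =>
    rw [up]
    split_ifs with h
    · exact h.2
    · simp

lemma dvd_of_mem_up {j p : ℕ} {u : ℕ × ℕ} (h : u ∈ up ℓ cap j p) : ℓ ∣ p := by
  cases j with
  | zero => simp [up] at h
  | succ j =>
    by_contra hd
    simp [up, hd] at h

lemma fst_lt_of_mem_up {j p : ℕ} {u : ℕ × ℕ} (h : u ∈ up ℓ cap j p) : u.1 < j := by
  induction j generalizing p with
  | zero => simp [up] at h
  | succ j ih =>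
    rcases mem_closedUp.1 (up_succ_subset j p h) with rfl | h'
    · simp
    · exact (ih h').trans (Nat.lt_succ_self _)

lemma fst_le_of_mem_closedUp {u v : ℕ × ℕ} (h : u ∈ closedUp ℓ cap v) : u.1 ≤ v.1 := by
  rcases mem_closedUp.1 h with rfl | h
  · exact le_rfl
  · exact (fst_lt_of_mem_up h).le

lemma eq_of_mem_closedUp_of_fst_eq {u w v : ℕ × ℕ} (hu : u ∈ closedUp ℓ cap v)
    (hw : w ∈ closedUp ℓ cap v) (h : u.1 = w.1) : u = w := by
  obtain ⟨j, p⟩ := v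
  induction j generalizing p with
  | zero => simp_all [closedUp, up]
  | succ j ih =>
    rcases mem_closedUp.1 hu with rfl | hu' <;> rcases mem_closedUp.1 hw with rfl | hw'
    · rfl
    · exact absurd (fst_lt_of_mem_up hw') (by simp_all)
    · exact absurd (fst_lt_of_mem_up hu') (by simp_all)
    · exact ih _ (up_succ_subset _ _ hu') (up_succ_subset _ _ hw')

lemma eq_of_mem_closedUp_zero {u : ℕ × ℕ} {j : ℕ}
    (hu : u ∈ closedUp ℓ cap (j, 0)) : u = (j, 0) := by
  rcases mem_closedUp.1 hu with rfl | h
  · rfl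
  · cases j <;> simp [up] at h

lemma layeredGraph_adj {u v : ℕ × ℕ} : (layeredGraph ℓ cap).Adj u v ↔
    (u.1 = v.1 ∧ (u.2 + 1 = v.2 ∨ v.2 + 1 = u.2)) ∨
      u ∈ up ℓ cap v.1 v.2 ∨ v ∈ up ℓ cap u.1 u.2 := by
  rw [layeredGraph, SimpleGraph.fromRel_adj]
  constructor
  · rintro ⟨-, (h | h) | (h | h)⟩
    · exact Or.inl ⟨h.1, Or.inl h.2⟩
    · exact Or.inr (Or.inl h)
    · exact Or.inl ⟨h.1.symm, Or.inr h.2⟩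
    · exact Or.inr (Or.inr h)
  · rintro (⟨h, h' | h'⟩ | h | h)
    · exact ⟨fun e => by subst e; omega, Or.inl (Or.inl ⟨h, h'⟩)⟩
    · exact ⟨fun e => by subst e; omega, Or.inr (Or.inl ⟨h.symm, h'⟩)⟩
    · exact ⟨fun e => by subst e; exact lt_irrefl _ (fst_lt_of_mem_up h), Or.inl (Or.inr h)⟩
    · exact ⟨fun e => by subst e; exact lt_irrefl _ (fst_lt_of_mem_up h), Or.inr (Or.inr h)⟩

lemma closedUp_isClique (v : ℕ × ℕ) :
    (layeredGraph ℓ cap).IsClique (closedUp ℓ cap v : Set (ℕ × ℕ)) := by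
  obtain ⟨j, p⟩ := v
  induction j generalizing p with
  | zero => simp [closedUp, up]
  | succ j ih =>
    rw [closedUp, Finset.coe_insert, SimpleGraph.isClique_insert]
    refine ⟨(ih (p / (ℓ * 2 ^ (j + 1)))).subset (Finset.coe_subset.2 (up_succ_subset j p)), ?_⟩
    intro u hu _
    exact layeredGraph_adj.2 (Or.inr (Or.inr hu))

/-- Every small enough set of vertices in the closed upward neighbourhood of `(j, p)` is the set of
upward neighbours of some child of `(j, p)`. -/
lemma up_child (hℓ : 0 < ℓ) {j p : ℕ} {S : Finset (ℕ × ℕ)} (hS : S ⊆ closedUp ℓ cap (j, p))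
    (hcard : S.card ≤ cap (j + 1)) :
    up ℓ cap (j + 1) (ℓ * 2 ^ (j + 1) * p + ℓ * ∑ w ∈ S, 2 ^ w.1) = S ∧
      ℓ * ∑ w ∈ S, 2 ^ w.1 < ℓ * 2 ^ (j + 1) := by
  have hinj : Set.InjOn Prod.fst (S : Set (ℕ × ℕ)) := fun u hu w hw h =>
    eq_of_mem_closedUp_of_fst_eq (hS hu) (hS hw) h
  have hsum : ∑ w ∈ S, 2 ^ w.1 = ∑ i ∈ S.image Prod.fst, 2 ^ i :=
    (Finset.sum_image hinj).symm
  have hlt : ∑ w ∈ S, 2 ^ w.1 < 2 ^ (j + 1) := by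
    rw [hsum]
    refine Nat.geomSum_lt le_rfl fun i hi => ?_
    obtain ⟨w, hw, rfl⟩ := Finset.mem_image.1 hi
    exact Nat.lt_succ_of_le (fst_le_of_mem_closedUp (hS hw))
  have hlt' : ℓ * ∑ w ∈ S, 2 ^ w.1 < ℓ * 2 ^ (j + 1) := Nat.mul_lt_mul_of_pos_left hlt hℓ
  refine ⟨?_, hlt'⟩
  have hdiv : (ℓ * 2 ^ (j + 1) * p + ℓ * ∑ w ∈ S, 2 ^ w.1) / (ℓ * 2 ^ (j + 1)) = p := by
    rw [Nat.mul_add_div (by positivity), Nat.div_eq_of_lt hlt', add_zero]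
  have hdiv' : (ℓ * 2 ^ (j + 1) * p + ℓ * ∑ w ∈ S, 2 ^ w.1) / ℓ =
      2 ^ (j + 1) * p + ∑ w ∈ S, 2 ^ w.1 := by
    rw [mul_assoc, ← mul_add, Nat.mul_div_cancel_left _ hℓ]
  have hfil : (closedUp ℓ cap (j, p)).filter
      (fun w => (2 ^ (j + 1) * p + ∑ w ∈ S, 2 ^ w.1).testBit w.1) = S := by
    ext w
    rw [Finset.mem_filter]
    have hbit : ∀ w ∈ closedUp ℓ cap (j, p),
        ((2 ^ (j + 1) * p + ∑ w ∈ S, 2 ^ w.1).testBit w.1 = true ↔ w.1 ∈ S.image Prod.fst) := by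
      intro w hw
      rw [Nat.testBit_two_pow_mul_add _ hlt, if_pos (Nat.lt_succ_of_le (fst_le_of_mem_closedUp hw)),
        hsum, ← Nat.mem_bitIndices, ← List.mem_toFinset,
        Finset.toFinset_bitIndices_sum_two_pow]
    constructor
    · rintro ⟨hw, h⟩
      obtain ⟨u, hu, huw⟩ := Finset.mem_image.1 ((hbit w hw).1 h)
      rwa [← eq_of_mem_closedUp_of_fst_eq (hS hu) hw huw]
    · exact fun hw => ⟨hS hw, (hbit w (hS hw)).2 (Finset.mem_image_of_mem _ hw)⟩
  rw [up]
  rw [hdiv, hdiv', ← closedUp.eq_1 ℓ cap (j, p), hfil, if_pos]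
  refine ⟨?_, hcard⟩
  rw [mul_assoc]
  exact (dvd_mul_right _ _).add (dvd_mul_right _ _)

/-! ### Holes -/

/-- Every vertex of an induced cycle of length at least four has two distinct non-adjacent
neighbours on the cycle. -/
lemma exists_hole_neighbors {V : Type} {G : SimpleGraph V} {n : ℕ} (hn : 4 ≤ n)
    (f : SimpleGraph.cycleGraph n ↪g G) (i : Fin n) :
    ∃ a b, a ≠ b ∧ G.Adj (f i) (f a) ∧ G.Adj (f i) (f b) ∧ ¬ G.Adj (f a) (f b) := by
  obtain ⟨m, rfl⟩ : ∃ m, n = m + 2 := ⟨n - 2, by omega⟩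
  refine ⟨i - 1, i + 1, ?_, ?_, ?_, ?_⟩
  · intro h
    have h2 : (1 : Fin (m + 2)) + 1 = 0 := by
      have := sub_eq_iff_eq_add.1 h
      rw [add_assoc] at this
      exact left_eq_add.1 this
    have h3 := congrArg Fin.val h2
    rw [Fin.val_add, Fin.val_one, Fin.val_zero, Nat.mod_eq_of_lt (by omega)] at h3
    omega
  · rw [f.map_adj_iff, SimpleGraph.cycleGraph_adj]; left; abel
  · rw [f.map_adj_iff, SimpleGraph.cycleGraph_adj]; right; abel
  · rw [f.map_adj_iff, SimpleGraph.cycleGraph_adj]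
    rintro (h | h)
    · have h2 : (1 : Fin (m + 2)) + 1 + 1 = 0 := by
        have h3 : i - 1 - (i + 1) = -(1 + 1) := by abel
        rw [h3] at h
        rw [neg_eq_iff_eq_neg.1 h, neg_add_cancel]
      have h3 := congrArg Fin.val h2
      rw [Fin.val_add, Fin.val_add, Fin.val_one, Fin.val_zero,
        Nat.mod_eq_of_lt (a := 1 + 1) (by omega), Nat.mod_eq_of_lt (by omega)] at h3
      omega
    · have h2 : (1 : Fin (m + 2)) = 0 := by
        have h3 : i + 1 - (i - 1) = 1 + 1 := by abel
        rw [h3] at h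
        exact left_eq_add.1 h.symm
      have h3 := congrArg Fin.val h2
      rw [Fin.val_one, Fin.val_zero] at h3
      omega

/-- The lowest layer that meets a hole contains a path of at least `ℓ` vertices of the hole: if `p`
is the last position of the hole in this layer, then `(j, p)` has an upward neighbour, so `ℓ ∣ p`,
and the hole cannot leave the layer before the preceding multiple of `ℓ`. -/
lemma le_of_hole {n : ℕ} (hn : 4 ≤ n) (f : SimpleGraph.cycleGraph n ↪g layeredGraph ℓ cap) :
    ℓ ≤ n := by
  have : Nonempty (Fin n) := ⟨⟨0, by omega⟩⟩
  obtain ⟨i₀, hi₀⟩ := Finite.exists_max fun i => (f i).1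
  have hne : (Finset.univ.filter fun i => (f i).1 = (f i₀).1).Nonempty := ⟨i₀, by simp⟩
  obtain ⟨i₁, hi₁, hmax⟩ := Finset.exists_max_image _ (fun i => (f i).2) hne
  simp only [Finset.mem_filter, Finset.mem_univ, true_and] at hi₁ hmax
  set j := (f i₀).1 with hj
  set p := (f i₁).2 with hp
  have hf₁ : f i₁ = (j, p) := Prod.ext hi₁ rfl
  have hne' : ∀ a b, a ≠ b → f a ≠ f b := fun a b h h' => h (f.injective h')
  -- A neighbour on the hole of a vertex of the lowest layer is beside it or above it.
  have hnbr : ∀ i q, f i = (j, q) → ∀ a, (layeredGraph ℓ cap).Adj (f i) (f a) →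
      (f a = (j, q + 1) ∨ f a = (j, q - 1) ∧ 1 ≤ q) ∨ f a ∈ up ℓ cap j q := by
    intro i q hi a h
    rw [hi, layeredGraph_adj] at h
    rcases h with ⟨h1, h2 | h2⟩ | h | h
    · exact Or.inl (Or.inl (Prod.ext h1.symm h2.symm))
    · exact Or.inl (Or.inr
        ⟨Prod.ext h1.symm (by simp only at h2 ⊢; omega), by simp only at h2; omega⟩)
    · exact absurd (fst_lt_of_mem_up h) (not_lt.2 (hi₀ a))
    · exact Or.inr h
  have hstart : ℓ ∣ p ∧ (∃ i, f i = (j, p - 1) ∧ 1 ≤ p) := by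
    obtain ⟨a, b, hab, ha, hb, hnab⟩ := exists_hole_neighbors hn f i₁
    have hnot : ∀ a, f a ≠ (j, p + 1) := by
      intro a h
      have := hmax a (by rw [h])
      rw [h] at this
      simp at this
    rcases hnbr i₁ p hf₁ a ha with (h | h) | h <;> rcases hnbr i₁ p hf₁ b hb with (h' | h') | h'
    · exact absurd h (hnot a)
    · exact absurd h (hnot a)
    · exact absurd h (hnot a)
    · exact absurd h' (hnot b)
    · exact absurd (h.1.trans h'.1.symm) (hne' a b hab)
    · exact ⟨dvd_of_mem_up h', a, h⟩
    · exact absurd h' (hnot b)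
    · exact ⟨dvd_of_mem_up h, b, h'⟩
    · exact absurd (closedUp_isClique (j, p) (mem_closedUp.2 (Or.inr h))
        (mem_closedUp.2 (Or.inr h')) (hne' a b hab)) hnab
  have hall : ∀ t, t < ℓ → ∃ i, f i = (j, p - t) ∧ t ≤ p := by
    intro t ht
    induction t with
    | zero => exact ⟨i₁, hf₁, Nat.zero_le _⟩
    | succ t ih =>
      rcases Nat.eq_zero_or_pos t with rfl | htpos
      · exact hstart.2
      obtain ⟨i, hi, htp⟩ := ih (by omega)
      have hnd : ∀ u, u ∉ up ℓ cap j (p - t) := by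
        intro u hu
        have hd := (Nat.dvd_sub_iff_right htp hstart.1).1 (dvd_of_mem_up hu)
        exact absurd (Nat.le_of_dvd htpos hd) (by omega)
      obtain ⟨a, b, hab, ha, hb, -⟩ := exists_hole_neighbors hn f i
      have hgoal : ∀ c, f c = (j, p - t - 1) ∧ 1 ≤ p - t → ∃ i, f i = (j, p - (t + 1)) ∧ t + 1 ≤ p :=
        fun c hc => ⟨c, by rw [hc.1, Nat.sub_sub], by omega⟩
      rcases hnbr i _ hi a ha with (h | h) | h
      · rcases hnbr i _ hi b hb with (h' | h') | h'
        · exact absurd (h.trans h'.symm) (hne' a b hab)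
        · exact hgoal b h'
        · exact absurd h' (hnd _)
      · exact hgoal a h
      · exact absurd h (hnd _)
  choose g hg using fun t : Fin ℓ => hall t t.2
  have hinj : Function.Injective g := by
    intro s t hst
    have h1 := (hg s).1
    rw [hst, (hg t).1] at h1
    have h2 := congrArg Prod.snd h1
    have := (hg s).2
    have := (hg t).2
    simp only at h2
    exact Fin.ext (by omega)
  simpa using Fintype.card_le_of_injective g hinj

end LayeredGraph

/-! ### The lower bound on the tree-independence number -/

/-- The nodes whose bags meet a given walk, here a sequence of consecutively adjacent vertices,
induce a connected subgraph. -/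
lemma TreeDecomposition.connected_nodes_of_seq {V : Type} {G : SimpleGraph V}
    (T : TreeDecomposition G) (x : ℕ → V) (n : ℕ) (hx : ∀ t, t < n → G.Adj (x t) (x (t + 1))) :
    (T.tree.induce {s | ∃ t ≤ n, x t ∈ T.bag s}).Connected := by
  induction n with
  | zero =>
    have hset : {s | ∃ t ≤ 0, x t ∈ T.bag s} = {s | x 0 ∈ T.bag s} := by
      ext s
      exact ⟨fun ⟨t, ht, hs⟩ => Nat.le_zero.1 ht ▸ hs, fun hs => ⟨0, le_rfl, hs⟩⟩
    rw [hset]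
    exact T.connected_nodes (x 0)
  | succ n ih =>
    have hset : {s | ∃ t ≤ n + 1, x t ∈ T.bag s} =
        {s | ∃ t ≤ n, x t ∈ T.bag s} ∪ {s | x (n + 1) ∈ T.bag s} := by
      ext s
      constructor
      · rintro ⟨t, ht, hs⟩
        rcases Nat.lt_or_ge n t with h | h
        · obtain rfl : t = n + 1 := by omega
          exact Or.inr hs
        · exact Or.inl ⟨t, h, hs⟩
      · rintro (⟨t, ht, hs⟩ | hs)
        · exact ⟨t, by omega, hs⟩
        · exact ⟨n + 1, le_rfl, hs⟩
    rw [hset]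
    refine SimpleGraph.induce_union_connected (ih fun t ht => hx t (by omega)).preconnected
      (T.connected_nodes (x (n + 1))).preconnected ?_
    obtain ⟨s, hs, hs'⟩ := T.exists_edge_bag _ _ (hx n (Nat.lt_succ_self n))
    exact ⟨s, ⟨n, le_rfl, hs⟩, hs'⟩

section LayeredGraph

variable {ℓ : ℕ} {cap : ℕ → ℕ}

/-- Vertices in distinct layers form a graph in which every vertex has few upward neighbours, so
that removing closed upward neighbourhoods greedily yields a large independent set. -/
lemma exists_isIndepSet {d : ℕ} (S : Finset (ℕ × ℕ)) (hinj : Set.InjOn Prod.fst (S : Set (ℕ × ℕ)))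
    (hcap : ∀ v ∈ S, cap v.1 ≤ d) :
    ∃ I ⊆ S, (layeredGraph ℓ cap).IsIndepSet (I : Set (ℕ × ℕ)) ∧ S.card ≤ (d + 1) * I.card := by
  induction S using Finset.strongInduction with
  | H S ih =>
    rcases S.eq_empty_or_nonempty with rfl | hne
    · exact ⟨∅, by simp⟩
    obtain ⟨v, hv, hmax⟩ := S.exists_max_image Prod.fst hne
    have hss : S \ closedUp ℓ cap v ⊂ S :=
      Finset.ssubset_iff_subset_ne.2 ⟨Finset.sdiff_subset, fun h => by
        rw [← h] at hv
        exact (Finset.mem_sdiff.1 hv).2 (self_mem_closedUp v)⟩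
    obtain ⟨I, hIS, hI, hcard⟩ := ih _ hss
      (hinj.mono (Finset.coe_subset.2 hss.1)) fun v hv => hcap v (hss.1 hv)
    have hvI : v ∉ I := fun h => (Finset.mem_sdiff.1 (hIS h)).2 (self_mem_closedUp v)
    have hnadj : ∀ w ∈ I, ¬ (layeredGraph ℓ cap).Adj v w := by
      intro w hw hadj
      obtain ⟨hwS, hwv⟩ := Finset.mem_sdiff.1 (hIS hw)
      rcases layeredGraph_adj.1 hadj with h | h | h
      · exact hvI (hinj hv hwS h.1 ▸ hw)
      · exact absurd (fst_lt_of_mem_up h) (not_lt.2 (hmax w hwS))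
      · exact hwv (mem_closedUp.2 (Or.inr h))
    refine ⟨insert v I, Finset.insert_subset hv (hIS.trans hss.1), ?_, ?_⟩
    · rw [Finset.coe_insert, SimpleGraph.isIndepSet_iff, Set.pairwise_insert]
      exact ⟨hI, fun w hw _ => ⟨hnadj w hw, fun h => hnadj w hw h.symm⟩⟩
    · have h1 : S.card ≤ (S \ closedUp ℓ cap v).card + (closedUp ℓ cap v).card := by
        rw [← Nat.sub_le_iff_le_add]
        exact Finset.le_card_sdiff _ _
      have h2 : (closedUp ℓ cap v).card ≤ d + 1 :=
        (Finset.card_insert_le _ _).trans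
          (Nat.succ_le_succ ((up_card_le _ _).trans (hcap v hv)))
      rw [Finset.card_insert_of_notMem hvI]
      linarith

/-- The number of descendants in layer `j` of a vertex of layer `0`. -/
def layerWidth (ℓ j : ℕ) : ℕ := ∏ t ∈ Finset.range j, ℓ * 2 ^ (t + 1)

lemma layerWidth_pos (hℓ : 0 < ℓ) (j : ℕ) : 0 < layerWidth ℓ j :=
  Finset.prod_pos fun _ _ => by positivity

/-- Any two layers are adjacent, even when restricted to the descendants of the vertex `(0, 1)`. -/
lemma exists_mem_up_of_lt (hℓ : 0 < ℓ) (hcap : ∀ j, 1 ≤ j → 1 ≤ cap j) {i j : ℕ} (hij : i < j) :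
    ∃ p, layerWidth ℓ j ≤ p ∧ p < 2 * layerWidth ℓ j ∧
      (i, layerWidth ℓ i) ∈ up ℓ cap j p := by
  have hstep : ∀ j p, layerWidth ℓ j ≤ p → p < 2 * layerWidth ℓ j →
      (i, layerWidth ℓ i) ∈ closedUp ℓ cap (j, p) →
      ∃ p, layerWidth ℓ (j + 1) ≤ p ∧ p < 2 * layerWidth ℓ (j + 1) ∧
        (i, layerWidth ℓ i) ∈ up ℓ cap (j + 1) p := by
    intro j p h1 h2 h3
    obtain ⟨hup, hlt⟩ := up_child hℓ (Finset.singleton_subset_iff.2 h3)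
      (by simpa using hcap (j + 1) (Nat.le_add_left 1 j))
    have hW : layerWidth ℓ (j + 1) = layerWidth ℓ j * (ℓ * 2 ^ (j + 1)) :=
      Finset.prod_range_succ _ _
    refine ⟨_, ?_, ?_, by rw [hup]; exact Finset.mem_singleton_self _⟩
    · rw [hW, mul_comm]
      exact (Nat.mul_le_mul_left _ h1).trans (Nat.le_add_right _ _)
    · refine (Nat.add_lt_add_left hlt _).trans_le ?_
      rw [hW, ← Nat.mul_succ, ← mul_assoc, mul_comm]
      exact Nat.mul_le_mul_right _ h2
  induction j, hij using Nat.le_induction with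
  | base =>
    have := layerWidth_pos hℓ i
    exact hstep i _ le_rfl (by omega) (self_mem_closedUp _)
  | succ j _ ih =>
    obtain ⟨p, h1, h2, h3⟩ := ih
    exact hstep j p h1 h2 (mem_closedUp.2 (Or.inr h3))

/-- The first `N` layers, restricted to the descendants of the vertex `(0, 1)`. -/
def layerWindow (ℓ N : ℕ) : Set (ℕ × ℕ) :=
  {v | v.1 < N ∧ layerWidth ℓ v.1 ≤ v.2 ∧ v.2 < 2 * layerWidth ℓ v.1}

lemma layerWindow_finite (ℓ N : ℕ) : (layerWindow ℓ N).Finite := by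
  refine ((Finset.range N).sigma fun j => Finset.range (2 * layerWidth ℓ j)).finite_toSet.image
    (fun x => (x.1, x.2)) |>.subset ?_
  rintro ⟨j, p⟩ ⟨h1, -, h3⟩
  exact ⟨⟨j, p⟩, by simpa using ⟨h1, h3⟩, rfl⟩

/-- The layers of the window are connected and pairwise adjacent, so some bag of every tree
decomposition meets all of them, and contains a large independent set. -/
lemma le_mul_treeIndependenceNumber (hℓ : 0 < ℓ) {N d : ℕ} (hN : 0 < N)
    (hcap : ∀ j, 1 ≤ j → 1 ≤ cap j) (hd : ∀ j, j < N → cap j ≤ d) {c : ℕ} (hc : (d + 1) * c ≤ N) :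
    c ≤ treeIndependenceNumber ((layeredGraph ℓ cap).induce (layerWindow ℓ N)) := by
  classical
  have := (layerWindow_finite ℓ N).to_subtype
  have := Fintype.ofFinite (layerWindow ℓ N)
  have : Nonempty (Fin N) := ⟨⟨0, hN⟩⟩
  refine le_treeIndependenceNumber fun T => ?_
  let B : Fin N → Set (layerWindow ℓ N) := fun j => {v | v.1.1 = j}
  have hB : ∀ j, (T.tree.induce {s | (T.bag s ∩ B j).Nonempty}).Connected := by
    intro j
    have hpos := layerWidth_pos hℓ j
    let x : ℕ → layerWindow ℓ N := fun t =>
      ⟨(j, layerWidth ℓ j + min t (layerWidth ℓ j - 1)), j.2, by simp, by simp only; omega⟩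
    have hset : {s | (T.bag s ∩ B j).Nonempty} =
        {s | ∃ t ≤ layerWidth ℓ j - 1, x t ∈ T.bag s} := by
      ext s
      constructor
      · rintro ⟨⟨⟨j', p⟩, h1, h2, h3⟩, hs, hj⟩
        obtain rfl : j' = j := hj
        simp only at h1 h2 h3
        refine ⟨p - layerWidth ℓ j, by omega, ?_⟩
        have hxp : x (p - layerWidth ℓ j) = ⟨(j, p), h1, h2, h3⟩ :=
          Subtype.ext (Prod.ext rfl (by simp only [x]; omega))
        rwa [hxp]
      · rintro ⟨t, -, hs⟩
        exact ⟨_, hs, rfl⟩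
    rw [hset]
    refine T.connected_nodes_of_seq x _ fun t ht => ?_
    refine layeredGraph_adj.2 (Or.inl ⟨rfl, Or.inl ?_⟩)
    simp only [x, Function.Embedding.subtype_apply]
    omega
  have hBB : ∀ i j, ∃ s, (T.bag s ∩ B i).Nonempty ∧ (T.bag s ∩ B j).Nonempty := by
    have hlt : ∀ i j, i < j → ∃ s, (T.bag s ∩ B i).Nonempty ∧ (T.bag s ∩ B j).Nonempty := by
      intro i j hij
      obtain ⟨p, h1, h2, h3⟩ := exists_mem_up_of_lt hℓ hcap (Fin.lt_def.1 hij)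
      have hpos := layerWidth_pos hℓ i
      let u : layerWindow ℓ N := ⟨(i, layerWidth ℓ i), i.2, le_rfl, by simp only; omega⟩
      let v : layerWindow ℓ N := ⟨(j, p), j.2, h1, h2⟩
      obtain ⟨s, hu, hv⟩ := T.exists_edge_bag u v (layeredGraph_adj.2 (Or.inr (Or.inl h3)))
      exact ⟨s, ⟨u, hu, rfl⟩, ⟨v, hv, rfl⟩⟩
    intro i j
    rcases lt_trichotomy i j with h | rfl | h
    · exact hlt i j h
    · obtain ⟨⟨s, v, hv⟩⟩ := (hB i).nonempty
      exact ⟨s, ⟨v, hv⟩, ⟨v, hv⟩⟩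
    · obtain ⟨s, h1, h2⟩ := hlt j i h
      exact ⟨s, h2, h1⟩
  obtain ⟨s, hs⟩ := T.exists_bag_meets_all B hB hBB
  refine ⟨s, ?_⟩
  choose x hx hxB using hs
  let S : Finset (ℕ × ℕ) := Finset.univ.image fun j => (x j).1
  have hSinj : Function.Injective fun j => (x j).1 := fun i j h =>
    Fin.ext ((hxB i).symm.trans ((congrArg Prod.fst h).trans (hxB j)))
  have hSmem : ∀ v ∈ S, ∃ j, (x j).1 = v := fun v hv => by simpa [S] using hv
  obtain ⟨I, hIS, hI, hcard⟩ := exists_isIndepSet (ℓ := ℓ) (cap := cap) (d := d) S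
    (by
      intro u hu v hv h
      obtain ⟨i, rfl⟩ := hSmem u hu
      obtain ⟨j, rfl⟩ := hSmem v hv
      obtain rfl : i = j := Fin.ext ((hxB i).symm.trans (h.trans (hxB j)))
      rfl)
    (by
      intro v hv
      obtain ⟨j, rfl⟩ := hSmem v hv
      exact hd _ (x j).2.1)
  have hScard : S.card = N := by
    rw [Finset.card_image_of_injective _ hSinj, Finset.card_univ, Fintype.card_fin]
  have hcI : c ≤ I.card := by
    rw [hScard] at hcard
    exact Nat.le_of_mul_le_mul_left (hc.trans hcard) (Nat.succ_pos d)
  have hI' : (((layeredGraph ℓ cap).induce (layerWindow ℓ N)).induce (T.bag s)).IsIndepSet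
      (Finset.univ.filter fun y : T.bag s => y.1.1 ∈ I : Finset (T.bag s)) := by
    intro y hy z hz hyz
    simp only [Finset.coe_filter, Finset.mem_univ, true_and, Set.mem_ofPred_eq] at hy hz
    exact hI hy hz fun h => hyz (Subtype.ext (Subtype.ext h))
  refine hcI.trans (le_trans ?_ hI'.card_le_indepNum)
  refine (Finset.card_le_card ?_).trans
    (Finset.card_image_le (f := fun y : T.bag s => y.1.1))
  intro v hv
  obtain ⟨j, rfl⟩ := hSmem v (hIS hv)
  exact Finset.mem_image.2 ⟨⟨x j, hx j⟩, by simpa using hv, rfl⟩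

end LayeredGraph

/-! ### Lines -/

section Lines

variable (ℓ : ℕ) (cap : ℕ → ℕ) (X : Finset (ℕ × ℕ))

/-- The upward neighbours of the next vertex of the line through `v`: the part of `X` in the closed
upward neighbourhood of `v`, unless this set is too large for the next layer. -/
def lineUp (v : ℕ × ℕ) : Finset (ℕ × ℕ) :=
  if (closedUp ℓ cap v ∩ X).card ≤ cap (v.1 + 1) then closedUp ℓ cap v ∩ X else ∅

/-- The child of `v` whose set of upward neighbours is `lineUp ℓ cap X v`. The iterates of this
function at `v` form the line that starts in `v`; it visits every layer below `v` once. -/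
def lineChild (v : ℕ × ℕ) : ℕ × ℕ :=
  (v.1 + 1, ℓ * 2 ^ (v.1 + 1) * v.2 + ℓ * ∑ w ∈ lineUp ℓ cap X v, 2 ^ w.1)

/-- The vertex `v` lies on the line that starts in `u`. -/
def OnLine (v u : ℕ × ℕ) : Prop := ∃ t, (lineChild ℓ cap X)^[t] u = v

variable {ℓ cap X}

lemma lineUp_subset (v : ℕ × ℕ) : lineUp ℓ cap X v ⊆ closedUp ℓ cap v := by
  rw [lineUp]
  split_ifs
  · exact Finset.inter_subset_left
  · exact Finset.empty_subset _

lemma lineUp_card_le (v : ℕ × ℕ) : (lineUp ℓ cap X v).card ≤ cap (v.1 + 1) := by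
  rw [lineUp]
  split_ifs with h
  · exact h
  · simp

lemma up_lineChild (hℓ : 0 < ℓ) (v : ℕ × ℕ) :
    up ℓ cap (lineChild ℓ cap X v).1 (lineChild ℓ cap X v).2 = lineUp ℓ cap X v :=
  (up_child hℓ (lineUp_subset v) (lineUp_card_le v)).1

lemma lineChild_snd_lt (hℓ : 0 < ℓ) (v : ℕ × ℕ) :
    (lineChild ℓ cap X v).2 < ℓ * 2 ^ (v.1 + 1) * (v.2 + 1) := by
  have := (up_child (cap := cap) hℓ (lineUp_subset (X := X) v) (lineUp_card_le v)).2
  rw [mul_add, mul_one]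
  exact Nat.add_lt_add_left this _

lemma le_lineChild_snd (v : ℕ × ℕ) : ℓ * 2 ^ (v.1 + 1) * v.2 ≤ (lineChild ℓ cap X v).2 :=
  Nat.le_add_right _ _

lemma parentVertex_lineChild (hℓ : 0 < ℓ) (v : ℕ × ℕ) :
    parentVertex ℓ (lineChild ℓ cap X v) = v := by
  refine Prod.ext rfl ?_
  have hpos : 0 < ℓ * 2 ^ (v.1 + 1) := by positivity
  refine Nat.div_eq_of_lt_le ?_ ?_
  · rw [mul_comm]; exact le_lineChild_snd v
  · rw [mul_comm]; exact lineChild_snd_lt hℓ v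

lemma lineChild_injective (hℓ : 0 < ℓ) : Function.Injective (lineChild ℓ cap X) :=
  Function.LeftInverse.injective (parentVertex_lineChild hℓ)

lemma lineChild_strictMono (hℓ : 0 < ℓ) (j : ℕ) :
    StrictMono fun p => (lineChild ℓ cap X (j, p)).2 := by
  intro p q hpq
  exact (lineChild_snd_lt hℓ (j, p)).trans_le
    ((Nat.mul_le_mul_left _ hpq).trans (le_lineChild_snd (j, q)))

lemma lineChild_zero (hX : ∀ v ∈ X, v.2 ≠ 0) (j : ℕ) :
    lineChild ℓ cap X (j, 0) = (j + 1, 0) := by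
  have h : closedUp ℓ cap (j, 0) ∩ X = ∅ := by
    rw [← Finset.disjoint_iff_inter_eq_empty, Finset.disjoint_left]
    intro v hv hvX
    exact hX v hvX (by rw [eq_of_mem_closedUp_zero hv])
  simp [lineChild, lineUp, h]

lemma iterate_lineChild_fst (t : ℕ) (u : ℕ × ℕ) : ((lineChild ℓ cap X)^[t] u).1 = u.1 + t := by
  induction t generalizing u with
  | zero => rfl
  | succ t ih => rw [Function.iterate_succ_apply, ih]; simp only [lineChild]; omega

lemma le_iterate_lineChild_snd (hℓ : 0 < ℓ) (t : ℕ) (u : ℕ × ℕ) :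
    u.2 ≤ ((lineChild ℓ cap X)^[t] u).2 := by
  induction t generalizing u with
  | zero => rfl
  | succ t ih =>
    rw [Function.iterate_succ_apply]
    exact ((lineChild_strictMono hℓ u.1).le_apply (x := u.2)).trans (ih _)

lemma onLine_refl (v : ℕ × ℕ) : OnLine ℓ cap X v v := ⟨0, rfl⟩

/-- Deep in the graph, lines are chosen so that their vertices in `X` form a clique: once a line
has visited such a vertex, all its later vertices are adjacent to it. -/
lemma mem_closedUp_iterate_lineChild (hℓ : 0 < ℓ) {L k : ℕ}
    (hk : ∀ v, (closedUp ℓ cap v ∩ X).card ≤ k) (hcap : ∀ j, L ≤ j → k ≤ cap j)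
    {w : ℕ × ℕ} (hw : w ∈ X) (hwL : L ≤ w.1) (t : ℕ) :
    w ∈ closedUp ℓ cap ((lineChild ℓ cap X)^[t] w) := by
  induction t with
  | zero => exact self_mem_closedUp w
  | succ t ih =>
    rw [Function.iterate_succ_apply', mem_closedUp, up_lineChild hℓ, lineUp, if_pos]
    · exact Or.inr (Finset.mem_inter.2 ⟨ih, hw⟩)
    · refine (hk _).trans (hcap _ ?_)
      rw [iterate_lineChild_fst]
      omega

open Classical in
/-- A line meets `X` at most once in each of the first `L` layers, and in a clique below them. -/
lemma card_onLine_le (hℓ : 0 < ℓ) {L k : ℕ} (hk : ∀ v, (closedUp ℓ cap v ∩ X).card ≤ k)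
    (hcap : ∀ j, L ≤ j → k ≤ cap j) (u : ℕ × ℕ) :
    (X.filter fun v => OnLine ℓ cap X v u).card ≤ L + k := by
  set A := X.filter fun v => OnLine ℓ cap X v u with hA
  have hinj : Set.InjOn Prod.fst (A : Set (ℕ × ℕ)) := by
    intro v hv w hw h
    obtain ⟨t, rfl⟩ := (Finset.mem_filter.1 hv).2
    obtain ⟨s, rfl⟩ := (Finset.mem_filter.1 hw).2
    rw [iterate_lineChild_fst, iterate_lineChild_fst] at h
    rw [Nat.add_left_cancel h]
  rw [← Finset.card_filter_add_card_filter_not (s := A) fun v => v.1 < L]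
  refine add_le_add ?_ ?_
  · rw [← Finset.card_image_of_injOn (hinj.mono (Finset.coe_subset.2 (Finset.filter_subset _ _)))]
    refine (Finset.card_le_card (t := Finset.range L) ?_).trans_eq (Finset.card_range L)
    intro j hj
    obtain ⟨v, hv, rfl⟩ := Finset.mem_image.1 hj
    exact Finset.mem_range.2 (Finset.mem_filter.1 hv).2
  · rcases (A.filter fun v => ¬ v.1 < L).eq_empty_or_nonempty with h | h
    · rw [h]
      exact Nat.zero_le k
    obtain ⟨v, hv, hmax⟩ := Finset.exists_max_image _ Prod.fst h
    refine (Finset.card_le_card ?_).trans (hk v)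
    intro w hw
    have hmaxw := hmax w hw
    rw [Finset.mem_filter, hA, Finset.mem_filter] at hv hw
    obtain ⟨t, rfl⟩ := hv.1.2
    obtain ⟨s, rfl⟩ := hw.1.2
    rw [iterate_lineChild_fst, iterate_lineChild_fst] at hmaxw
    obtain ⟨r, rfl⟩ : ∃ r, t = r + s := ⟨t - s, by omega⟩
    refine Finset.mem_inter.2 ⟨?_, hw.1.1⟩
    rw [Function.iterate_add_apply]
    exact mem_closedUp_iterate_lineChild hℓ hk hcap hw.1.1 (not_lt.1 hw.2) r

/-- The vertex `v` is relevant for the boundary at `u`: it lies on the line that starts in `u`, or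
in the closed upward neighbourhood of `u`. -/
def Touches (ℓ : ℕ) (cap : ℕ → ℕ) (X : Finset (ℕ × ℕ)) (v u : ℕ × ℕ) : Prop :=
  OnLine ℓ cap X v u ∨ v ∈ closedUp ℓ cap u

lemma touches_self (v : ℕ × ℕ) : Touches ℓ cap X v v := Or.inl (onLine_refl v)

open Classical in
lemma card_touches_le (hℓ : 0 < ℓ) {L k : ℕ} (hk : ∀ v, (closedUp ℓ cap v ∩ X).card ≤ k)
    (hcap : ∀ j, L ≤ j → k ≤ cap j) (u : ℕ × ℕ) :
    (X.filter fun v => Touches ℓ cap X v u).card ≤ L + 2 * k := by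
  have hsub : (X.filter fun v => Touches ℓ cap X v u) ⊆
      (X.filter fun v => OnLine ℓ cap X v u) ∪ (closedUp ℓ cap u ∩ X) := by
    intro v hv
    obtain ⟨hvX, hv | hv⟩ := Finset.mem_filter.1 hv
    · exact Finset.mem_union_left _ (Finset.mem_filter.2 ⟨hvX, hv⟩)
    · exact Finset.mem_union_right _ (Finset.mem_inter.2 ⟨hv, hvX⟩)
  have h1 := Finset.card_le_card hsub
  have h2 := Finset.card_union_le (X.filter fun v => OnLine ℓ cap X v u) (closedUp ℓ cap u ∩ X)
  have h3 := card_onLine_le hℓ hk hcap u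
  have h4 := hk u
  omega

/-- The vertices at whose boundary `v` is relevant form a tree under `parentVertex`, whose top `a`
is the start of the longest line through `v`. -/
lemma exists_top_touches (hℓ : 0 < ℓ) (v : ℕ × ℕ) : ∃ a, OnLine ℓ cap X v a ∧
    (∀ u, Touches ℓ cap X v u → u ≠ a → 1 ≤ u.1 ∧ Touches ℓ cap X v (parentVertex ℓ u)) ∧
    ∀ u, lineChild ℓ cap X u ≠ a := by
  obtain ⟨a, ha, hmin⟩ := (InvImage.wf Prod.fst Nat.lt_wfRel.wf).has_min
    {u | OnLine ℓ cap X v u} ⟨v, onLine_refl v⟩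
  have hmin' : ∀ u, OnLine ℓ cap X v u → a.1 ≤ u.1 := fun u hu => not_lt.1 (hmin u hu)
  refine ⟨a, ha, ?_, ?_⟩
  · have hline : ∀ u, OnLine ℓ cap X v u → u ≠ a →
        1 ≤ u.1 ∧ Touches ℓ cap X v (parentVertex ℓ u) := by
      rintro u ⟨t, ht⟩ hne
      obtain ⟨s, hs⟩ := ha
      have hle := hmin' u ⟨t, ht⟩
      have h1 := congrArg Prod.fst (ht.trans hs.symm)
      rw [iterate_lineChild_fst, iterate_lineChild_fst] at h1
      obtain ⟨r, rfl⟩ : ∃ r, s = t + r := ⟨s - t, by omega⟩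
      rw [← ht, Function.iterate_add_apply] at hs
      have hu := (lineChild_injective hℓ).iterate t hs
      cases r with
      | zero => exact absurd hu.symm hne
      | succ r =>
        rw [Function.iterate_succ_apply'] at hu
        rw [← hu, parentVertex_lineChild hℓ]
        refine ⟨Nat.succ_le_succ (Nat.zero_le _), Or.inl ⟨t + 1, ?_⟩⟩
        rw [Function.iterate_succ_apply, hu, ht]
    rintro u (hu | hu) hne
    · exact hline u hu hne
    · rcases mem_closedUp.1 hu with rfl | hu
      · exact hline v (onLine_refl v) hne
      · obtain ⟨j, p⟩ := u
        cases j with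
        | zero => simp [up] at hu
        | succ j => exact ⟨Nat.succ_le_succ (Nat.zero_le _), Or.inr (up_succ_subset j p hu)⟩
  · rintro u rfl
    obtain ⟨t, ht⟩ := ha
    have : (lineChild ℓ cap X u).1 ≤ u.1 := hmin' u ⟨t + 1, ht⟩
    simp [lineChild] at this

/-! ### The tree of gaps -/

/-- A pair `(j, q)` is also used as the name of the gap between the positions `q` and `q + 1` of
layer `j`. For a gap in layer `j + 1`, this is the gap `(j, p)` for which `(j + 1, q)` lies between
the lines that start in `(j, p)` and `(j, p + 1)`. For a gap in layer `0` it has no meaning. -/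
def outerGap (ℓ : ℕ) (cap : ℕ → ℕ) (X : Finset (ℕ × ℕ)) (e : ℕ × ℕ) : ℕ × ℕ :=
  (e.1 - 1, Nat.findGreatest (fun p => (lineChild ℓ cap X (e.1 - 1, p)).2 ≤ e.2) e.2)

lemma outerGap_spec (hℓ : 0 < ℓ) (hX : ∀ v ∈ X, v.2 ≠ 0) (e : ℕ × ℕ) :
    (lineChild ℓ cap X (outerGap ℓ cap X e)).2 ≤ e.2 ∧
      e.2 < (lineChild ℓ cap X ((outerGap ℓ cap X e).1, (outerGap ℓ cap X e).2 + 1)).2 := by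
  refine ⟨Nat.findGreatest_spec (P := fun p => (lineChild ℓ cap X (e.1 - 1, p)).2 ≤ e.2)
    (Nat.zero_le _) (by rw [lineChild_zero hX]; exact Nat.zero_le _), ?_⟩
  by_contra! h
  have h1 := ((lineChild_strictMono hℓ (e.1 - 1)).le_apply
    (x := (outerGap ℓ cap X e).2 + 1)).trans h
  have h2 : (outerGap ℓ cap X e).2 + 1 ≤ (outerGap ℓ cap X e).2 :=
    Nat.le_findGreatest (P := fun p => (lineChild ℓ cap X (e.1 - 1, p)).2 ≤ e.2) h1 h
  omega

lemma outerGap_eq (hℓ : 0 < ℓ) (hX : ∀ v ∈ X, v.2 ≠ 0) {e : ℕ × ℕ} {p : ℕ}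
    (h1 : (lineChild ℓ cap X (e.1 - 1, p)).2 ≤ e.2)
    (h2 : e.2 < (lineChild ℓ cap X (e.1 - 1, p + 1)).2) : outerGap ℓ cap X e = (e.1 - 1, p) := by
  obtain ⟨h3, h4⟩ := outerGap_spec (cap := cap) hℓ hX e
  have hm := lineChild_strictMono (cap := cap) (X := X) hℓ (e.1 - 1)
  have h5 : (outerGap ℓ cap X e).2 < p + 1 := hm.lt_iff_lt.1 (h3.trans_lt h2)
  have h6 : p < (outerGap ℓ cap X e).2 + 1 := hm.lt_iff_lt.1 (h1.trans_lt h4)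
  exact Prod.ext rfl (by simp only; omega)

/-- The parents of the two ends of a gap are among the two ends of the outer gap. -/
lemma parentVertex_mem_outerGap (hℓ : 0 < ℓ) (hX : ∀ v ∈ X, v.2 ≠ 0) {e u : ℕ × ℕ} (he : 1 ≤ e.1)
    (hu : u = e ∨ u = (e.1, e.2 + 1)) :
    parentVertex ℓ u = outerGap ℓ cap X e ∨
      parentVertex ℓ u = ((outerGap ℓ cap X e).1, (outerGap ℓ cap X e).2 + 1) := by
  obtain ⟨h1, h2⟩ := outerGap_spec (cap := cap) hℓ hX e
  obtain ⟨j, q⟩ := e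
  obtain ⟨j, rfl⟩ : ∃ i, j = i + 1 := ⟨j - 1, by simp only at he; omega⟩
  set p := (outerGap ℓ cap X (j + 1, q)).2 with hp
  have hg : outerGap ℓ cap X (j + 1, q) = (j, p) := rfl
  rw [hg] at h1 h2 ⊢
  simp only at h1 h2 hu ⊢
  have hu1 : u.1 = j + 1 := by rcases hu with rfl | rfl <;> rfl
  have hu2 : (lineChild ℓ cap X (j, p)).2 ≤ u.2 ∧ u.2 ≤ (lineChild ℓ cap X (j, p + 1)).2 := by
    rcases hu with rfl | rfl <;> constructor <;> simp only <;> omega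
  have h3 : ∀ p, (lineChild ℓ cap X (j, p)).2 / (ℓ * 2 ^ (j + 1)) = p := fun p =>
    congrArg Prod.snd (parentVertex_lineChild (cap := cap) (X := X) hℓ (j, p))
  have h4 := Nat.div_le_div_right (c := ℓ * 2 ^ (j + 1)) hu2.1
  have h5 := Nat.div_le_div_right (c := ℓ * 2 ^ (j + 1)) hu2.2
  rw [h3] at h4 h5
  simp only [parentVertex, hu1, Prod.mk.injEq, Nat.add_sub_cancel, true_and]
  omega

/-- The parent of a gap in the tree of gaps: the preceding gap of the layer if it has the same
outer gap, and the outer gap otherwise. -/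
def gapParent (ℓ : ℕ) (cap : ℕ → ℕ) (X : Finset (ℕ × ℕ)) (e : ℕ × ℕ) : ℕ × ℕ :=
  if e.1 = 0 ∨ (lineChild ℓ cap X (outerGap ℓ cap X e)).2 < e.2 then (e.1, e.2 - 1)
  else outerGap ℓ cap X e

lemma gapParent_le (e : ℕ × ℕ) :
    (gapParent ℓ cap X e).1 ≤ e.1 ∧ (gapParent ℓ cap X e).2 ≤ e.2 := by
  rw [gapParent]
  split_ifs
  · exact ⟨le_rfl, Nat.sub_le _ _⟩
  · exact ⟨Nat.sub_le _ _, Nat.findGreatest_le _⟩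

lemma gapParent_lt {e : ℕ × ℕ} (he : e ≠ (0, 0)) :
    (gapParent ℓ cap X e).1 + (gapParent ℓ cap X e).2 < e.1 + e.2 := by
  have hle := gapParent_le (ℓ := ℓ) (cap := cap) (X := X) e
  rw [gapParent] at hle ⊢
  split_ifs at hle ⊢ with h
  · have : e.2 ≠ 0 := by
      rintro h2
      rcases h with h | h
      · exact he (Prod.ext h h2)
      · omega
    simp only
    omega
  · have h1 : (outerGap ℓ cap X e).1 = e.1 - 1 := rfl
    omega

/-- The vertex `v` is relevant for the boundary at one of the two ends of a gap. -/
def TouchesGap (ℓ : ℕ) (cap : ℕ → ℕ) (X : Finset (ℕ × ℕ)) (v e : ℕ × ℕ) : Prop :=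
  Touches ℓ cap X v e ∨ Touches ℓ cap X v (e.1, e.2 + 1)

/-- The vertex `v` belongs to the bag of the gap `e`: it is relevant for the boundary of `e` or of
its outer gap. -/
def InGapBag (ℓ : ℕ) (cap : ℕ → ℕ) (X : Finset (ℕ × ℕ)) (v e : ℕ × ℕ) : Prop :=
  TouchesGap ℓ cap X v e ∨ 1 ≤ e.1 ∧ TouchesGap ℓ cap X v (outerGap ℓ cap X e)

/-- The gaps whose bag contains a vertex `v` have a top: the gap before the start of the longest
line through `v`. -/
lemma exists_top_inGapBag (hℓ : 0 < ℓ) (hX : ∀ v ∈ X, v.2 ≠ 0) {v : ℕ × ℕ} (hv : v.2 ≠ 0) :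
    ∃ a : ℕ × ℕ, a.1 ≤ v.1 ∧ a.2 ≤ v.2 ∧ InGapBag ℓ cap X v a ∧
      ∀ e, InGapBag ℓ cap X v e → e ≠ a → e ≠ (0, 0) ∧ InGapBag ℓ cap X v (gapParent ℓ cap X e) := by
  obtain ⟨a, hva, hpar, hnot⟩ := exists_top_touches (cap := cap) (X := X) hℓ v
  have ha0 : a.2 ≠ 0 := by
    intro h
    have hz : ∀ t j, (lineChild ℓ cap X)^[t] (j, 0) = (j + t, 0) := by
      intro t
      induction t with
      | zero => intro j; rfl
      | succ t ih =>
        intro j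
        rw [Function.iterate_succ_apply, lineChild_zero hX, ih]
        exact Prod.ext (by simp only; omega) rfl
    obtain ⟨t, rfl⟩ := hva
    obtain ⟨j, p⟩ := a
    obtain rfl : p = 0 := h
    exact hv (by rw [hz])
  have hale : a.1 ≤ v.1 ∧ a.2 ≤ v.2 := by
    obtain ⟨t, rfl⟩ := hva
    exact ⟨by rw [iterate_lineChild_fst]; omega, le_iterate_lineChild_snd hℓ t a⟩
  have hprev : ((a.1, a.2 - 1).1, (a.1, a.2 - 1).2 + 1) = a :=
    Prod.ext rfl (Nat.sub_add_cancel (Nat.pos_of_ne_zero ha0))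
  have htop : TouchesGap ℓ cap X v (a.1, a.2 - 1) := by
    right
    rw [hprev]
    exact Or.inl hva
  refine ⟨(a.1, a.2 - 1), hale.1, (Nat.sub_le _ _).trans hale.2, Or.inl htop, ?_⟩
  have houter : ∀ e : ℕ × ℕ, 1 ≤ e.1 → TouchesGap ℓ cap X v (outerGap ℓ cap X e) →
      e ≠ (0, 0) ∧ InGapBag ℓ cap X v (gapParent ℓ cap X e) := by
    intro e he h
    refine ⟨by rintro rfl; simp at he, ?_⟩
    rw [gapParent]
    split_ifs with hc
    · right
      refine ⟨he, ?_⟩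
      have hlt := hc.resolve_left (by omega)
      rw [outerGap_eq (e := (e.1, e.2 - 1)) (p := (outerGap ℓ cap X e).2) hℓ hX
        (Nat.le_sub_one_of_lt hlt)
        ((Nat.sub_le _ _).trans_lt (outerGap_spec hℓ hX e).2)]
      exact h
    · exact Or.inl h
  intro e he hne
  rcases he with he | ⟨he1, he⟩
  · obtain ⟨u, hu, hvu⟩ : ∃ u, (u = e ∨ u = (e.1, e.2 + 1)) ∧ Touches ℓ cap X v u := by
      rcases he with he | he
      · exact ⟨_, Or.inl rfl, he⟩
      · exact ⟨_, Or.inr rfl, he⟩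
    by_cases hua : u = a
    · rcases hu with rfl | rfl
      · subst hua
        refine ⟨fun h => ha0 (by rw [h]), ?_⟩
        rw [gapParent, if_pos]
        · exact Or.inl htop
        · by_contra! hc
          refine hnot (outerGap ℓ cap X u) (Prod.ext ?_
            (le_antisymm (outerGap_spec hℓ hX u).1 hc.2))
          have := hc.1
          simp only [lineChild, outerGap]
          omega
      · exact absurd (by rw [← hua]; rfl) hne
    · obtain ⟨hu1, hup⟩ := hpar u hvu hua
      have he1 : 1 ≤ e.1 := by rcases hu with rfl | rfl <;> exact hu1
      refine houter e he1 ?_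
      rcases parentVertex_mem_outerGap (cap := cap) hℓ hX he1 hu with h | h
      · exact Or.inl (h ▸ hup)
      · exact Or.inr (h ▸ hup)
  · exact houter e he1 he

end Lines

/-! ### The upper bound on treewidth -/

/-- If every layer from `L` on admits cliques of the size of the clique number `k` of `H`, then
every line has at most `L + k` vertices in `H`, and the tree of gaps yields a bound on the
treewidth of `H`. -/
lemma treewidth_le_of_embedding {ℓ : ℕ} {cap : ℕ → ℕ} (hℓ : 0 < ℓ) {V : Type} [Finite V]
    (H : SimpleGraph V) (f : H ↪g layeredGraph ℓ cap) (hf : ∀ v, (f v).2 ≠ 0) {L : ℕ}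
    (hcap : ∀ j, L ≤ j → H.cliqueNum ≤ cap j) :
    treewidth H ≤ 4 * (L + 2 * H.cliqueNum) := by
  classical
  have := Fintype.ofFinite V
  set X : Finset (ℕ × ℕ) := Finset.univ.image f with hXdef
  have hmem : ∀ v, f v ∈ X := fun v => Finset.mem_image_of_mem _ (Finset.mem_univ v)
  have hX : ∀ u ∈ X, u.2 ≠ 0 := by
    intro u hu
    obtain ⟨v, -, rfl⟩ := Finset.mem_image.1 hu
    exact hf v
  have hk : ∀ u, (closedUp ℓ cap u ∩ X).card ≤ H.cliqueNum := by
    intro u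
    have hcl : H.IsClique (Finset.univ.filter fun v => f v ∈ closedUp ℓ cap u : Finset V) := by
      intro v hv w hw hvw
      simp only [Finset.coe_filter, Finset.mem_univ, true_and, Set.mem_ofPred_eq] at hv hw
      exact f.map_adj_iff.1 (closedUp_isClique u hv hw fun h => hvw (f.injective h))
    refine (Finset.card_le_card ?_).trans
      ((Finset.card_image_le (f := f)).trans hcl.card_le_cliqueNum)
    intro w hw
    obtain ⟨hw1, hw2⟩ := Finset.mem_inter.1 hw
    obtain ⟨v, -, rfl⟩ := Finset.mem_image.1 hw2
    exact Finset.mem_image_of_mem _ (by simpa using hw1)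
  let N := X.sup Prod.fst
  let Q := X.sup Prod.snd
  have hbox : ∀ v, (f v).1 ≤ N ∧ (f v).2 ≤ Q := fun v =>
    ⟨Finset.le_sup (f := Prod.fst) (hmem v), Finset.le_sup (f := Prod.snd) (hmem v)⟩
  let Node := {e : ℕ × ℕ // e.1 ≤ N ∧ e.2 ≤ Q}
  have hfin : Finite Node := by
    refine Set.Finite.to_subtype (s := {e : ℕ × ℕ | e.1 ≤ N ∧ e.2 ≤ Q}) ?_
    exact ((Set.finite_Iic N).prod (Set.finite_Iic Q)).subset fun e he => he
  refine treewidth_le_of_parent H (α := Node)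
    (fun e => ⟨gapParent ℓ cap X e.1, (gapParent_le e.1).1.trans e.2.1,
      (gapParent_le e.1).2.trans e.2.2⟩)
    ⟨(0, 0), Nat.zero_le _, Nat.zero_le _⟩ (fun e => e.1.1 + e.1.2)
    (fun e he => gapParent_lt fun h => he (Subtype.ext h))
    (fun e => {v | InGapBag ℓ cap X (f v) e.1}) ?_ ?_ ?_
  · intro u v huv
    have huv' := layeredGraph_adj.1 (f.map_adj_iff.2 huv)
    have hself : ∀ v, InGapBag ℓ cap X (f v) (f v) := fun v => Or.inl (Or.inl (touches_self _))
    rcases huv' with ⟨h1, h2 | h2⟩ | h | h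
    · refine ⟨⟨f u, hbox u⟩, hself u, Or.inl (Or.inr ?_)⟩
      rw [h1, h2]
      exact touches_self _
    · refine ⟨⟨f v, hbox v⟩, Or.inl (Or.inr ?_), hself v⟩
      rw [← h1, h2]
      exact touches_self _
    · exact ⟨⟨f v, hbox v⟩, Or.inl (Or.inl (Or.inr (mem_closedUp.2 (Or.inr h)))), hself v⟩
    · exact ⟨⟨f u, hbox u⟩, hself u, Or.inl (Or.inl (Or.inr (mem_closedUp.2 (Or.inr h))))⟩
  · intro v
    obtain ⟨a, ha1, ha2, ha, htop⟩ := exists_top_inGapBag (cap := cap) hℓ hX (hf v)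
    refine ⟨⟨a, ha1.trans (hbox v).1, ha2.trans (hbox v).2⟩, ha, fun e he hne => ?_⟩
    obtain ⟨h1, h2⟩ := htop e.1 he fun h => hne (Subtype.ext h)
    exact ⟨fun h => h1 (congrArg Subtype.val h), h2⟩
  · rintro ⟨e, he⟩
    let t : ℕ × ℕ → Finset (ℕ × ℕ) := fun u => X.filter fun v => Touches ℓ cap X v u
    have ht : ∀ u, (t u).card ≤ L + 2 * H.cliqueNum := card_touches_le hℓ hk hcap
    have hncard : {v | InGapBag ℓ cap X (f v) e}.ncard ≤ ((t e ∪ t (e.1, e.2 + 1)) ∪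
        (t (outerGap ℓ cap X e) ∪
          t ((outerGap ℓ cap X e).1, (outerGap ℓ cap X e).2 + 1))).card := by
      rw [← Set.ncard_coe_finset]
      refine Set.ncard_le_ncard_of_injOn f ?_ f.injective.injOn (Finset.finite_toSet _)
      intro v hv
      have hm : ∀ u, Touches ℓ cap X (f v) u → f v ∈ t u := fun u hu =>
        Finset.mem_filter.2 ⟨hmem v, hu⟩
      rw [Finset.mem_coe]
      rcases hv with (h | h) | ⟨-, h | h⟩
      · exact Finset.mem_union_left _ (Finset.mem_union_left _ (hm _ h))
      · exact Finset.mem_union_left _ (Finset.mem_union_right _ (hm _ h))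
      · exact Finset.mem_union_right _ (Finset.mem_union_left _ (hm _ h))
      · exact Finset.mem_union_right _ (Finset.mem_union_right _ (hm _ h))
    have h1 := Finset.card_union_le (t e ∪ t (e.1, e.2 + 1)) (t (outerGap ℓ cap X e) ∪
      t ((outerGap ℓ cap X e).1, (outerGap ℓ cap X e).2 + 1))
    have h2 := Finset.card_union_le (t e) (t (e.1, e.2 + 1))
    have h3 := Finset.card_union_le (t (outerGap ℓ cap X e))
      (t ((outerGap ℓ cap X e).1, (outerGap ℓ cap X e).2 + 1))
    have h4 := ht e
    have h5 := ht (e.1, e.2 + 1)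
    have h6 := ht (outerGap ℓ cap X e)
    have h7 := ht ((outerGap ℓ cap X e).1, (outerGap ℓ cap X e).2 + 1)
    simp only
    omega

/-! ### The class of graphs -/

/-- The bound on the number of upward neighbours in layer `j` that belongs to `F`: the largest `k`
with `F (k + 1) ≤ j + 1`. -/
def capOf (F : ℕ → ℕ) (j : ℕ) : ℕ := Nat.findGreatest (fun k => F (k + 1) ≤ j + 1) j

lemma succ_le_of_step {F : ℕ → ℕ} (hF1 : F 1 = 1) (hF : ∀ k, 1 ≤ k → F k + 1 ≤ F (k + 1)) (k : ℕ) :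
    k + 1 ≤ F (k + 1) := by
  induction k with
  | zero => rw [hF1]
  | succ k ih => exact (Nat.succ_le_succ ih).trans (hF (k + 1) (Nat.le_add_left 1 k))

lemma le_capOf {F : ℕ → ℕ} (hF1 : F 1 = 1) (hF : ∀ k, 1 ≤ k → F k + 1 ≤ F (k + 1)) {j k : ℕ}
    (h : F (k + 1) ≤ j + 1) : k ≤ capOf F j :=
  Nat.le_findGreatest (by have := succ_le_of_step hF1 hF k; omega) h

lemma capOf_lt {F : ℕ → ℕ} (hF1 : F 1 = 1) (hF : ∀ k, 1 ≤ k → F k + 1 ≤ F (k + 1)) {j k : ℕ}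
    (h : j + 1 < F (k + 1)) : capOf F j < k := by
  have hmono : Monotone fun k => F (k + 1) := monotone_nat_of_le_succ fun k =>
    (Nat.le_succ _).trans (hF (k + 1) (Nat.le_add_left 1 k))
  have hspec : F (capOf F j + 1) ≤ j + 1 :=
    Nat.findGreatest_spec (P := fun k => F (k + 1) ≤ j + 1) (Nat.zero_le j)
      (by rw [zero_add, hF1]; exact Nat.le_add_left 1 j)
  by_contra! hk
  have := hmono hk
  simp only at this
  omega

/-- The finite induced subgraphs of the layered graph that avoid the first vertex of every layer.
The line that starts in the first vertex of layer `0` visits the first vertices only, so that it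
serves as a border that costs nothing: every vertex of the graph lies to its right. -/
def layeredClass (ℓ : ℕ) (F : ℕ → ℕ) : GraphClass := fun V _ H =>
  ∃ f : H ↪g layeredGraph ℓ (capOf F), ∀ v : V, (f v).2 ≠ 0

lemma layeredClass_isHereditary (ℓ : ℕ) (F : ℕ → ℕ) : (layeredClass ℓ F).IsHereditary := by
  rintro V W _ _ G H ⟨f, hf⟩ ⟨g⟩
  exact ⟨f.comp g, fun v => hf (g v)⟩

lemma treewidth_le_of_layeredClass {ℓ : ℕ} (hℓ : 0 < ℓ) {F : ℕ → ℕ} (hF1 : F 1 = 1)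
    (hF : ∀ k, 1 ≤ k → F k + 1 ≤ F (k + 1)) {V : Type} [Finite V] {H : SimpleGraph V}
    (h : layeredClass ℓ F V H) :
    treewidth H ≤ 4 * (F (H.cliqueNum + 1) + 2 * H.cliqueNum) := by
  obtain ⟨f, hf⟩ := h
  exact treewidth_le_of_embedding hℓ H f hf fun j hj => le_capOf hF1 hF (hj.trans (Nat.le_succ j))

lemma exists_le_treeIndependenceNumber {ℓ : ℕ} (hℓ : 0 < ℓ) {F : ℕ → ℕ} (hF : IsSuperLinear F)
    (hF1 : F 1 = 1) (hF2 : F 2 = 2) (hFstep : ∀ k, 1 ≤ k → F k + 1 ≤ F (k + 1)) (c : ℕ) :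
    ∃ (V : Type) (_ : Finite V) (H : SimpleGraph V),
      layeredClass ℓ F V H ∧ c ≤ treeIndependenceNumber H := by
  -- The summand `2` excludes `k = 1`, where `F k = 1`, and absorbs the `- 1` in the number of
  -- layers.
  obtain ⟨k, hk, hck⟩ := hF (c + 2)
  obtain ⟨m, rfl⟩ : ∃ m, k = m + 2 := by
    refine ⟨k - 2, ?_⟩
    have : k ≠ 1 := by
      rintro rfl
      omega
    omega
  have hfin : Finite (layerWindow ℓ (F (m + 2) - 1)) := (layerWindow_finite _ _).to_subtype
  have hlin : (c + 2) * (m + 2) = (m + 1) * c + c + 2 * (m + 2) := by ring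
  refine ⟨layerWindow ℓ (F (m + 2) - 1), hfin, _, ⟨SimpleGraph.Embedding.induce _, ?_⟩,
    le_mul_treeIndependenceNumber (cap := capOf F) (d := m) hℓ ?_ ?_ ?_ ?_⟩
  · rintro ⟨⟨j, p⟩, h1, h2, h3⟩ h
    have := layerWidth_pos hℓ j
    have hp : p = 0 := h
    simp only at h2
    omega
  · omega
  · exact fun j hj => le_capOf hF1 hFstep (by rw [hF2]; omega)
  · intro j hj
    have hj' : j + 1 < F (m + 1 + 1) := Nat.add_lt_of_lt_sub hj
    exact Nat.le_of_lt_succ (capOf_lt hF1 hFstep hj')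
  · omega

theorem mainTheorem1 (ℓ : ℕ) (hℓ : 4 ≤ ℓ) (F : ℕ → ℕ) (hF : IsSuperLinear F)
    (hF1 : F 1 = 1) (hF2 : F 2 = 2) (hFstep : ∀ k : ℕ, 1 ≤ k → F k + 1 ≤ F (k + 1)) :
    (∃ C : GraphClass,
      C.IsHereditary ∧
      (∀ (V : Type) [Finite V] (H : SimpleGraph V), C V H →
        ∀ n : ℕ, HasHoleOfLength H n → ℓ ≤ n) ∧
      (∀ c : ℕ, ∃ (V : Type) (_ : Finite V) (H : SimpleGraph V),
        C V H ∧ c ≤ treeIndependenceNumber H) ∧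
      (∀ (V : Type) [Finite V] [Nonempty V] (H : SimpleGraph V), C V H →
        treewidth H ≤
          15 * ((F (H.cliqueNum + 1) : ℤ) + ((ℓ : ℤ) + 1) * (H.cliqueNum : ℤ) - 2))) ∧
    ¬ DallardMilanicStorgelConjecture := by
  have hpos : 0 < ℓ := by omega
  refine ⟨⟨layeredClass ℓ F, layeredClass_isHereditary ℓ F, ?_,
    exists_le_treeIndependenceNumber hpos hF hF1 hF2 hFstep, ?_⟩, ?_⟩
  · rintro V _ H ⟨f, -⟩ n ⟨hn, ⟨g⟩⟩
    exact le_of_hole hn (f.comp g)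
  · intro V _ _ H hH
    have h1 := treewidth_le_of_layeredClass hpos hF1 hFstep hH
    have hω : 1 ≤ H.cliqueNum := by
      obtain ⟨v⟩ := ‹Nonempty V›
      have : H.IsClique (({v} : Finset V) : Set V) := by simp
      simpa using this.card_le_cliqueNum
    have h2 := succ_le_of_step hF1 hFstep H.cliqueNum
    have h3 : (5 : ℤ) * H.cliqueNum ≤ ((ℓ : ℤ) + 1) * H.cliqueNum := by
      gcongr
      omega
    omega
  · intro hconj
    obtain ⟨c, hc⟩ := (hconj _ (layeredClass_isHereditary ℓ F)).1
      ⟨fun k => 4 * (F (k + 1) + 2 * k), fun V _ H hH => by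
        exact_mod_cast treewidth_le_of_layeredClass hpos hF1 hFstep hH⟩
    obtain ⟨V, hV, H, hH, hcH⟩ := exists_le_treeIndependenceNumber hpos hF hF1 hF2 hFstep (c + 1)
    have := hc V H hH
    omega
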